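/- Let $\Lambda\subset\mathbb C$ be a lattice (a discrete subgroup spanning $\mathbb C$ over $\mathbb R$), let $T=\mathbb C/\Lambda$ be the flat torus with its Euclidean metric and area measure $\mathrm{vol}$, and let $\gamma$ be an oriented closed geodesic on $T$ with deck transformation $z\mapsto z+\tau$, $\tau\in\Lambda\setminus\{0\}$; that is, $\gamma$ is the projection of an oriented segment from some $z_0$ to $z_0+\tau$. For $x\in T$ and $t>0$ let $\mathbb W^t_x$ be the law, on $C([0,t],T)$ with the uniform topology, of Brownian motion on $T$ started at $x$ with generator the Laplacian $\Delta$ (the projection to $T$ of $r\mapsto z+B_{2r}$, where $z$ is a lift of $x$ and $B$ is a standard planar Brownian motion started at $0$). For $y\in T$ let $$\mathbb W^t_{x\to y}=\lim_{\varepsilon\to0+}\frac{\mathbb W^t_x\,\mathbf 1_{\{W_t\in D_\varepsilon(y)\}}}{\mathrm{vol}(D_\varepsilon(y))}$$ (weak limit of finite measures, where $D_\varepsilon(y)$ is the metric disk of radius $\varepsilon$ about $y$). The Brownian loop measure $\mu_T$ is the image of $$\mu_T^*=\int_0^\infty\frac{\mathrm dt}{t}\int_T\mathbb W^t_{x\to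 x}\,\mathrm d\mathrm{vol}(x)$$ on the space of oriented loops modulo orientation-preserving reparametrization (forgetting root and time parametrization). Let $\mathcal C_T(\gamma)$ be the set of loops freely homotopic to $\gamma$, and let $p_{\mathbb C}(z,w;t)=\frac1{4\pi t}e^{-|z-w|^2/4t}$ be the Euclidean heat kernel. Then for every fundamental domain $F\subset\mathbb C$ of $\Lambda$, $$\mu_T(\mathcal C_T(\gamma))=\int_0^\infty\frac1t\iint_F p_{\mathbb C}(z,z+\tau;t)\,\mathrm dx\,\mathrm dy\,\mathrm dt=\frac{\mathrm{Area}(T)}{\pi|\tau|^2},\qquad z=x+iy.$$ -/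

import Mathlib

open MeasureTheory ProbabilityTheory Filter Topology Set
open scoped NNReal ENNReal unitInterval

noncomputable section

/-- Spaces of continuous maps carry the Borel σ-algebra of the topology of uniform convergence
on compact sets. -/
instance continuousMapMeasurableSpace {X Y : Type*} [TopologicalSpace X] [TopologicalSpace Y] :
    MeasurableSpace C(X, Y) := borel _

instance continuousMapBorelSpace {X Y : Type*} [TopologicalSpace X] [TopologicalSpace Y] :
    BorelSpace C(X, Y) := ⟨rfl⟩

/-- The law on `C([0, ∞), ℂ)` of a standard planar Brownian motion started at `0`: the real and
imaginary parts of the canonical process are independent standard real Brownian motions. -/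
structure IsPlanarBrownianLaw (P : Measure C(ℝ≥0, ℂ)) : Prop where
  re : IsBrownianReal (fun (t : ℝ≥0) (B : C(ℝ≥0, ℂ)) => (B t).re) P
  im : IsBrownianReal (fun (t : ℝ≥0) (B : C(ℝ≥0, ℂ)) => (B t).im) P
  indep : IndepFun (fun (B : C(ℝ≥0, ℂ)) (t : ℝ≥0) => (B t).re)
    (fun (B : C(ℝ≥0, ℂ)) (t : ℝ≥0) => (B t).im) P

/-- The heat kernel of the Laplacian on the Euclidean plane. -/
def heatKernel (z w : ℂ) (t : ℝ) : ℝ :=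
  1 / (4 * Real.pi * t) * Real.exp (-‖z - w‖ ^ 2 / (4 * t))

/-- The flat torus `ℂ / Λ`. Its distance is the quotient distance
`d(π z, π w) = inf_{l ∈ Λ} |z - w + l|`. -/
abbrev FlatTorus (Λ : Submodule ℤ ℂ) : Type := ℂ ⧸ Λ

/-- The projection `ℂ → ℂ / Λ`. -/
def torusMk (Λ : Submodule ℤ ℂ) (z : ℂ) : FlatTorus Λ := Submodule.Quotient.mk z

theorem continuous_torusMk (Λ : Submodule ℤ ℂ) : Continuous (torusMk Λ) :=
  continuous_quot_mk

section Torus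

variable (Λ : Submodule ℤ ℂ) [DiscreteTopology Λ] [IsZLattice ℝ Λ]

/-- The Riemannian volume of the flat torus: the image of Lebesgue measure on a fundamental
parallelogram of `Λ`. -/
def torusVolume : Measure (FlatTorus Λ) :=
  Measure.map (torusMk Λ) ((volume : Measure ℂ).restrict
    (ZSpan.fundamentalDomain ((Module.Free.chooseBasis ℤ Λ).ofZLatticeBasis ℝ Λ)))

/-- The area of the flat torus. -/
def torusArea : ℝ := (torusVolume Λ).real univ

variable {Λ}

/-- Paths of duration `t` are recorded by their trajectory on `[0, 1]`, run in proportion to the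
elapsed time. This is the trajectory on `[0, t]` of the speed-`2` Brownian motion on the torus
started at `x`, the projection of `r ↦ z + B (2 r)` for any lift `z` of `x`. -/
def torusPath (t : ℝ≥0) (x : FlatTorus Λ) (B : C(ℝ≥0, ℂ)) : C(I, FlatTorus Λ) where
  toFun s := x + torusMk Λ (B (2 * (t * unitInterval.toNNReal s)))
  continuous_toFun := by
    have := continuous_torusMk Λ
    fun_prop

/-- The law of the speed-`2` Brownian motion on the torus on `[0, t]`, started at `x`. -/
def torusBrownian (P : ProbabilityMeasure C(ℝ≥0, ℂ)) (t : ℝ≥0) (x : FlatTorus Λ) :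
    FiniteMeasure C(I, FlatTorus Λ) :=
  P.toFiniteMeasure.map (torusPath t x)

/-- The measure on paths from `x` to `y` of duration `t`: the weak limit, as `ε → 0+`, of
Brownian motion from `x` restricted to ending in the disk of radius `ε` about `y`, divided by the
area of that disk. -/
def torusBridge (P : ProbabilityMeasure C(ℝ≥0, ℂ)) (t : ℝ≥0) (x y : FlatTorus Λ) :
    FiniteMeasure C(I, FlatTorus Λ) :=
  limUnder (𝓝[>] (0 : ℝ)) fun ε : ℝ =>
    ((torusVolume Λ (Metric.ball y ε)).toNNReal)⁻¹ •
      (torusBrownian P t x).restrict {W | W 1 ∈ Metric.ball y ε}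

variable (Λ)

/-- Parametrized loops: a duration `t > 0`, and the trajectory on `[0, 1]` after scaling time
by `t`. -/
def ParametrizedLoop : Type := {p : ℝ × C(I, FlatTorus Λ) // 0 < p.1 ∧ p.2 0 = p.2 1}

instance : MeasurableSpace (ParametrizedLoop Λ) :=
  inferInstanceAs (MeasurableSpace {p : ℝ × C(I, FlatTorus Λ) // 0 < p.1 ∧ p.2 0 = p.2 1})

/-- The parametrized Brownian loop measure `∫_0^∞ dt / t ∫_T W^t_{x → x} dvol(x)`. -/
def parametrizedLoopMeasure (P : ProbabilityMeasure C(ℝ≥0, ℂ)) : Measure (ParametrizedLoop Λ) :=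
  Measure.comap Subtype.val <|
    Measure.bind
      ((((volume : Measure ℝ).restrict (Ioi 0)).withDensity
        fun t => ENNReal.ofReal (1 / t)).prod (torusVolume Λ))
      fun p => (Measure.dirac p.1).prod
        (torusBridge P p.1.toNNReal p.2 p.2 : Measure C(I, FlatTorus Λ))

/-- Two loops parametrized by `ℝ / ℤ` are equivalent if they differ by an orientation-preserving
homeomorphism of `ℝ / ℤ`, i.e. by one that lifts to an increasing bijection of `ℝ` commuting with
the translation by `1`. -/
def loopSetoid : Setoid C(AddCircle (1 : ℝ), FlatTorus Λ) where
  r η η' := ∃ φ : ℝ ≃o ℝ, (∀ s, φ (s + 1) = φ s + 1) ∧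
    ∀ s : ℝ, η' (φ s : AddCircle (1 : ℝ)) = η (s : AddCircle (1 : ℝ))
  iseqv :=
    { refl := fun η => ⟨OrderIso.refl ℝ, fun _ => rfl, fun _ => rfl⟩
      symm := by
        rintro η η' ⟨φ, h1, h2⟩
        refine ⟨φ.symm, fun s => ?_, fun s => ?_⟩
        · rw [OrderIso.symm_apply_eq, h1, OrderIso.apply_symm_apply]
        · rw [← h2, OrderIso.apply_symm_apply]
      trans := by
        rintro η η' η'' ⟨φ, h1, h2⟩ ⟨ψ, k1, k2⟩
        refine ⟨φ.trans ψ, fun s => ?_, fun s => ?_⟩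
        · simp only [OrderIso.trans_apply, h1, k1]
        · rw [OrderIso.trans_apply, k2, h2] }

/-- Oriented loops up to the choice of the root and of the time parametrization. -/
def UnrootedLoop : Type := Quotient (loopSetoid Λ)

/-- The quotient topology. Reparametrization acts on loops by isometries of the sup distance, so
this is the topology of the sup distance modulo reparametrization. -/
instance : TopologicalSpace (UnrootedLoop Λ) :=
  inferInstanceAs (TopologicalSpace (Quotient (loopSetoid Λ)))

instance : MeasurableSpace (UnrootedLoop Λ) := borel _

instance : BorelSpace (UnrootedLoop Λ) := ⟨rfl⟩

variable {Λ}

/-- A path on `[0, 1]` with equal endpoints, as a map on `ℝ / ℤ`. -/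
def circleLoop (W : C(I, FlatTorus Λ)) (h : W 0 = W 1) : C(AddCircle (1 : ℝ), FlatTorus Λ) where
  toFun := AddCircle.liftIco 1 0 (IccExtend zero_le_one W)
  continuous_toFun := by
    refine AddCircle.liftIco_zero_continuous ?_ ?_
    · rw [IccExtend_left, IccExtend_right]
      exact h
    · exact W.continuous.Icc_extend'.continuousOn

/-- Forgetting the root and the time parametrization. -/
def ParametrizedLoop.toUnrooted (p : ParametrizedLoop Λ) : UnrootedLoop Λ :=
  Quotient.mk (loopSetoid Λ) (circleLoop p.1.2 p.2.2)

variable (Λ)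

/-- The Brownian loop measure of the flat torus, where `P` is the law of planar Brownian
motion. -/
def brownianLoopMeasure (P : ProbabilityMeasure C(ℝ≥0, ℂ)) : Measure (UnrootedLoop Λ) :=
  (parametrizedLoopMeasure Λ P).map ParametrizedLoop.toUnrooted

variable {Λ}

/-- The unrooted loops that are freely homotopic to `γ`. -/
def freeHomotopyClass (γ : C(AddCircle (1 : ℝ), FlatTorus Λ)) : Set (UnrootedLoop Λ) :=
  {l | ∃ η, Quotient.mk (loopSetoid Λ) η = l ∧ η.Homotopic γ}

/-- `γ` is an oriented closed geodesic of the flat torus whose deck transformation is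
`z ↦ z + τ`: it is the projection of an oriented segment from some `z₀` to `z₀ + τ`, with
`τ ≠ 0`. Since `γ` is periodic, `τ` belongs to `Λ`. -/
def IsClosedGeodesic (γ : C(AddCircle (1 : ℝ), FlatTorus Λ)) (τ : ℂ) : Prop :=
  τ ≠ 0 ∧ ∃ z₀ : ℂ, ∀ s : ℝ, γ (s : AddCircle (1 : ℝ)) = torusMk Λ (z₀ + s * τ)

end Torus

end

/-! ### The flat torus as a topological group -/

section FlatTorus

variable {Λ : Submodule ℤ ℂ}

/-! Up to time `2t`, a planar Brownian path is a bridge plus the linear drift `s * B (2t)`. The two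
parts are independent, because they are jointly Gaussian and uncorrelated
(`IsPlanarBrownianLaw.indepFun_bridgePart`). Conditioning on the endpoint therefore just fixes the
drift `w`. On the torus, returning near `x` means that `w` is near `Λ`. Unfolding over `Λ`
(`lintegral_indicator_torusMk`) and shrinking the disk shows that the measure on loops at `x` is `∑
l, p(0, l; t)` times the law of the projected bridge with drift `l` (`tendsto_torusBridge`,
`torusBridge_eq`).

A loop in the `l`-th term lifts to a path with displacement `l`. The displacement is a complete
invariant of free homotopy on the torus and is unchanged by reparametrization
(`mk_mem_freeHomotopyClass_iff`). So only `l = τ` contributes, with mass `p(0, τ; t)` for every `x`,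
and integration over `x` gives the factor of the area (`brownianLoopMeasure_freeHomotopyClass`). The
remaining time integral has an elementary antiderivative (`lintegral_Ioi_inv_mul_heatKernel`). -/

theorem torusMk_add (z w : ℂ) : torusMk Λ (z + w) = torusMk Λ z + torusMk Λ w := rfl

theorem torusMk_sub (z w : ℂ) : torusMk Λ (z - w) = torusMk Λ z - torusMk Λ w := rfl

theorem torusMk_zero : torusMk Λ 0 = 0 := rfl

theorem torusMk_eq_zero {z : ℂ} : torusMk Λ z = 0 ↔ z ∈ Λ :=
  Submodule.Quotient.mk_eq_zero Λ

theorem torusMk_surjective : Function.Surjective (torusMk Λ) :=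
  Submodule.Quotient.mk_surjective Λ

theorem isOpenMap_torusMk : IsOpenMap (torusMk Λ) :=
  Submodule.isOpenMap_mkQ Λ

theorem isOpenQuotientMap_torusMk : IsOpenQuotientMap (torusMk Λ) :=
  ⟨torusMk_surjective, continuous_torusMk Λ, isOpenMap_torusMk⟩

theorem measurable_torusMk : Measurable (torusMk Λ) :=
  measurable_quot_mk

instance : SecondCountableTopology (FlatTorus Λ) :=
  isOpenQuotientMap_torusMk.isQuotientMap.secondCountableTopology isOpenMap_torusMk

instance : OpensMeasurableSpace (FlatTorus Λ) := by
  refine ⟨MeasurableSpace.generateFrom_le fun s hs => ?_⟩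
  exact (IsOpen.preimage (continuous_torusMk Λ) hs).measurableSet

instance [DiscreteTopology Λ] : T2Space (FlatTorus Λ) := by
  have h : IsClosed (Λ : Set ℂ) := AddSubgroup.isClosed_of_discrete (H := Λ.toAddSubgroup)
  infer_instance

/-- A map with values near the origin of the torus lifts continuously to the plane. -/
theorem exists_forall_lift_of_dist_lt (Λ : Submodule ℤ ℂ) [DiscreteTopology Λ] :
    ∃ r > 0, ∀ (X : Type) [TopologicalSpace X] (g : C(X, FlatTorus Λ)),
      (∀ x, dist (g x) 0 < r) → ∃ f : C(X, ℂ), ∀ x, torusMk Λ (f x) = g x := by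
  -- With `r` half of a gap around `0` in `Λ`, two points of the disk of radius `r` cannot differ by
  -- a nonzero lattice vector, so the projection is injective there.
  obtain ⟨r, hr, hΛ⟩ : ∃ r > 0, ∀ z ∈ Λ, ‖z‖ < 2 * r → z = 0 := by
    obtain ⟨ε, hε, h⟩ := Metric.isOpen_singleton_iff.1 (isOpen_discrete {(0 : Λ)})
    refine ⟨ε / 2, half_pos hε, fun z hz hzε => ?_⟩
    have := h ⟨z, hz⟩ (by
      rw [dist_zero_right]
      exact lt_of_lt_of_eq hzε (by ring))
    exact congrArg Subtype.val this
  refine ⟨r, hr, fun X _ g hg => ?_⟩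
  let m : Metric.ball (0 : ℂ) r → FlatTorus Λ := fun z => torusMk Λ z
  have hm : IsOpenEmbedding m := by
    refine .of_continuous_injective_isOpenMap ((continuous_torusMk Λ).comp continuous_subtype_val)
      (fun z w hzw => ?_) (isOpenMap_torusMk.comp Metric.isOpen_ball.isOpenMap_subtype_val)
    have h1 : (z : ℂ) - w ∈ Λ := (Submodule.Quotient.eq Λ).1 hzw
    have h2 : ‖(z : ℂ) - w‖ < 2 * r := by
      have hz := mem_ball_zero_iff.1 z.2
      have hw := mem_ball_zero_iff.1 w.2
      linarith [norm_sub_le (z : ℂ) w]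
    exact Subtype.ext (sub_eq_zero.1 (hΛ _ h1 h2))
  have hrange : ∀ x, g x ∈ range m := fun x => by
    have : ‖g x‖ < r := by simpa [dist_zero_right] using hg x
    obtain ⟨z, hz, hzr⟩ := Submodule.Quotient.norm_mk_lt (g x) (sub_pos.2 this)
    exact ⟨⟨z, mem_ball_zero_iff.2 (hzr.trans_eq (by ring))⟩, hz⟩
  let e := hm.isEmbedding.toHomeomorph
  refine ⟨⟨fun x => (e.symm ⟨g x, hrange x⟩ : ℂ), by fun_prop⟩, fun x => ?_⟩
  exact congrArg Subtype.val (e.apply_symm_apply ⟨g x, hrange x⟩)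

end FlatTorus

/-! ### Free homotopy classes of loops -/

section Winding

variable {Λ : Submodule ℤ ℂ}

/-- The loops that lift to a path in the plane equivariant for the translation by `l`. -/
def windingClass (Λ : Submodule ℤ ℂ) (l : ℂ) : Set C(AddCircle (1 : ℝ), FlatTorus Λ) :=
  {η | ∃ f : C(ℝ, ℂ), (∀ s : ℝ, η (s : AddCircle (1 : ℝ)) = torusMk Λ (f s)) ∧
    ∀ s, f (s + 1) = f s + l}

theorem mem_lattice_of_mem_windingClass {l : ℂ} {η : C(AddCircle (1 : ℝ), FlatTorus Λ)}
    (h : η ∈ windingClass Λ l) : l ∈ Λ := by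
  obtain ⟨f, hf, hl⟩ := h
  have h0 := hf (0 + 1)
  rw [hl, AddCircle.coe_add_period, hf, torusMk_add, left_eq_add] at h0
  exact torusMk_eq_zero.1 h0

/-- Two lifts of a loop differ by a continuous function with values in the discrete `Λ`, hence by a
constant. -/
theorem eq_of_mem_windingClass [DiscreteTopology Λ] {l l' : ℂ}
    {η : C(AddCircle (1 : ℝ), FlatTorus Λ)}
    (h : η ∈ windingClass Λ l) (h' : η ∈ windingClass Λ l') : l = l' := by
  obtain ⟨f, hf, hl⟩ := h
  obtain ⟨f', hf', hl'⟩ := h'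
  have hmem : ∀ s, f s - f' s ∈ Λ := fun s => by
    rw [← torusMk_eq_zero, torusMk_sub, ← hf, ← hf', sub_self]
  have hc : Continuous fun s => (⟨f s - f' s, hmem s⟩ : Λ) := by fun_prop
  have := congrArg Subtype.val (PreconnectedSpace.constant inferInstance hc (x := 0 + 1) (y := 0))
  simp only [hl, hl'] at this
  linear_combination this

theorem mem_windingClass_of_add {l : ℂ} {η η' : C(AddCircle (1 : ℝ), FlatTorus Λ)}
    (h : η ∈ windingClass Λ l) (g : C(AddCircle (1 : ℝ), ℂ))
    (hg : ∀ s, η' s = η s + torusMk Λ (g s)) : η' ∈ windingClass Λ l := by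
  obtain ⟨f, hf, hl⟩ := h
  refine ⟨⟨fun s => f s + g (s : AddCircle (1 : ℝ)), ?_⟩, fun s => ?_, fun s => ?_⟩
  · have := AddCircle.continuous_mk' (1 : ℝ)
    exact f.continuous.add (g.continuous.comp this)
  · rw [hg, hf]; rfl
  · simp only [ContinuousMap.coe_mk, hl, AddCircle.coe_add_period]
    ring

/-- Loops at uniform distance below `r` differ by a loop that lifts to a closed loop in the plane,
which does not change the displacement. As `r` does not depend on the loop, this gives both openness
and closedness. -/
theorem isClopen_windingClass [DiscreteTopology Λ] (l : ℂ) : IsClopen (windingClass Λ l) := by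
  obtain ⟨r, hr, H⟩ := exists_forall_lift_of_dist_lt Λ
  have key : ∀ η η' : C(AddCircle (1 : ℝ), FlatTorus Λ), dist η' η < r →
      η ∈ windingClass Λ l → η' ∈ windingClass Λ l := by
    intro η η' hd hη
    obtain ⟨g, hg⟩ := H _ (η' - η) fun s => by
      rw [ContinuousMap.sub_apply, dist_zero_right, ← dist_eq_norm]
      exact (ContinuousMap.dist_apply_le_dist s).trans_lt hd
    refine mem_windingClass_of_add hη g fun s => ?_
    rw [hg, ContinuousMap.sub_apply, add_sub_cancel]
  constructor
  · refine isOpen_compl_iff.1 (Metric.isOpen_iff (α := C(AddCircle (1 : ℝ), FlatTorus Λ)).2 ?_)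
    exact fun η hη => ⟨r, hr, fun η' hd hη' => hη (key η' η (by rwa [dist_comm]) hη')⟩
  · refine Metric.isOpen_iff (α := C(AddCircle (1 : ℝ), FlatTorus Λ)).2 ?_
    exact fun η hη => ⟨r, hr, fun η' hd => key η η' hd hη⟩

/-- Lifts with the same displacement differ by a periodic function, so the straight-line homotopy
between them descends to the circle. -/
theorem homotopic_of_mem_windingClass {l : ℂ} {η η' : C(AddCircle (1 : ℝ), FlatTorus Λ)}
    (h : η ∈ windingClass Λ l) (h' : η' ∈ windingClass Λ l) : η.Homotopic η' := by
  obtain ⟨f, hf, hl⟩ := h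
  obtain ⟨f', hf', hl'⟩ := h'
  have hper : Function.Periodic (fun s => f' s - f s) (1 : ℝ) := fun s => by
    simp only [hl, hl']; ring
  have hcont : Continuous hper.lift := by
    refine continuous_quot_lift _ ?_
    fun_prop
  have hmk := continuous_torusMk Λ
  refine ⟨⟨⟨fun p => η p.2 + torusMk Λ (((p.1 : ℝ) : ℂ) * hper.lift p.2), by fun_prop⟩,
    fun s => ?_, fun s => ?_⟩⟩
  · simp [torusMk_zero]
  · induction s using QuotientAddGroup.induction_on with
    | H s =>
      have h1 := hf s
      have h2 := hf' s
      simp only [Set.Icc.coe_one, Complex.ofReal_one, one_mul]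
      rw [Function.Periodic.lift_coe, h1, h2, torusMk_sub, add_sub_cancel]

/-- A homotopy is a path in the loop space, and a path cannot leave a clopen set. -/
theorem mem_windingClass_of_homotopic [DiscreteTopology Λ] {l : ℂ}
    {η η' : C(AddCircle (1 : ℝ), FlatTorus Λ)}
    (h : η ∈ windingClass Λ l) (h' : η.Homotopic η') : η' ∈ windingClass Λ l := by
  obtain ⟨H⟩ := h'
  have hcl := (isClopen_windingClass (Λ := Λ) l).preimage H.curry.continuous
  have huniv := hcl.eq_univ ⟨0, by
    rw [mem_preimage]
    convert h
    ext s
    simp⟩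
  have h1 : (1 : I) ∈ H.curry ⁻¹' windingClass Λ l := huniv ▸ mem_univ _
  rw [mem_preimage] at h1
  convert h1
  ext s
  simp

theorem mem_windingClass_of_loopSetoid {l : ℂ} {η η' : C(AddCircle (1 : ℝ), FlatTorus Λ)}
    (h : η' ∈ windingClass Λ l) (hη : (loopSetoid Λ).r η η') : η ∈ windingClass Λ l := by
  obtain ⟨f, hf, hl⟩ := h
  obtain ⟨φ, hφ, hφη⟩ := hη
  refine ⟨⟨fun s => f (φ s), f.continuous.comp φ.continuous⟩, fun s => ?_, fun s => ?_⟩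
  · rw [← hφη, hf]; rfl
  · simp only [ContinuousMap.coe_mk, hφ, hl]

theorem IsClosedGeodesic.mem_windingClass {γ : C(AddCircle (1 : ℝ), FlatTorus Λ)} {τ : ℂ}
    (h : IsClosedGeodesic γ τ) : γ ∈ windingClass Λ τ := by
  obtain ⟨-, z₀, hz⟩ := h
  refine ⟨⟨fun s => z₀ + s * τ, by fun_prop⟩, hz, fun s => ?_⟩
  simp only [ContinuousMap.coe_mk, Complex.ofReal_add, Complex.ofReal_one]
  ring

theorem mk_mem_freeHomotopyClass_iff [DiscreteTopology Λ]
    {γ η : C(AddCircle (1 : ℝ), FlatTorus Λ)} {τ : ℂ} (hγ : γ ∈ windingClass Λ τ) :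
    Quotient.mk (loopSetoid Λ) η ∈ freeHomotopyClass γ ↔ η ∈ windingClass Λ τ := by
  constructor
  · rintro ⟨η', hη', hh⟩
    exact mem_windingClass_of_loopSetoid (mem_windingClass_of_homotopic hγ hh.symm)
      (Quotient.exact hη'.symm)
  · exact fun h => ⟨η, rfl, homotopic_of_mem_windingClass h hγ⟩

theorem isOpen_freeHomotopyClass [DiscreteTopology Λ]
    {γ : C(AddCircle (1 : ℝ), FlatTorus Λ)} {τ : ℂ} (hγ : γ ∈ windingClass Λ τ) :
    IsOpen (freeHomotopyClass γ) := by
  refine isOpen_coinduced.2 ?_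
  convert (isClopen_windingClass (Λ := Λ) τ).isOpen using 1
  ext η
  exact mk_mem_freeHomotopyClass_iff hγ

end Winding

/-! ### Independence -/

section Independence

theorem map_prod_prod_prod_comm {α β γ δ : Type*} [MeasurableSpace α] [MeasurableSpace β]
    [MeasurableSpace γ] [MeasurableSpace δ] (a : Measure α) (b : Measure β) (c : Measure γ)
    (d : Measure δ) [SFinite a] [SFinite b] [SFinite c] [SFinite d] :
    ((a.prod b).prod (c.prod d)).map (fun p => ((p.1.1, p.2.1), (p.1.2, p.2.2))) =
      (a.prod c).prod (b.prod d) := by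
  refine Measure.ext_of_lintegral _ fun f hf => ?_
  rw [lintegral_map hf (by fun_prop), lintegral_prod _ (by fun_prop), lintegral_prod _ (by fun_prop),
    lintegral_prod _ (by fun_prop), lintegral_prod _ (by fun_prop)]
  refine lintegral_congr fun x => ?_
  have h1 : ∀ y, ∫⁻ q : γ × δ, f ((x, q.1), (y, q.2)) ∂c.prod d =
      ∫⁻ z, ∫⁻ w, f ((x, z), (y, w)) ∂d ∂c := fun y => lintegral_prod _ (by fun_prop)
  have h2 : ∀ z, ∫⁻ q : β × δ, f ((x, z), q) ∂b.prod d =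
      ∫⁻ y, ∫⁻ w, f ((x, z), (y, w)) ∂d ∂b := fun y => lintegral_prod _ (by fun_prop)
  simp only [h1, h2]
  rw [lintegral_lintegral_swap]
  exact (Measurable.lintegral_prod_right' (f := fun p : (β × γ) × δ => f ((x, p.1.2), (p.1.1, p.2)))
    (by fun_prop)).aemeasurable

/-- Serves to pass from the real and imaginary parts to the plane: `A`, `C` will be the bridges of
the two coordinates and `B`, `D` their endpoints. -/
theorem indepFun_prodMk_prodMk_comm {Ω α β γ δ : Type*} [MeasurableSpace Ω] [MeasurableSpace α]
    [MeasurableSpace β] [MeasurableSpace γ] [MeasurableSpace δ] {P : Measure Ω} [IsFiniteMeasure P]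
    {A : Ω → α} {B : Ω → β} {C : Ω → γ} {D : Ω → δ} (hA : Measurable A) (hB : Measurable B)
    (hC : Measurable C) (hD : Measurable D) (hAB : IndepFun A B P) (hCD : IndepFun C D P)
    (h : IndepFun (fun ω => (A ω, B ω)) (fun ω => (C ω, D ω)) P) :
    IndepFun (fun ω => (A ω, C ω)) (fun ω => (B ω, D ω)) P := by
  have hAC : IndepFun A C P := h.comp measurable_fst measurable_fst
  have hBD : IndepFun B D P := h.comp measurable_snd measurable_snd
  rw [indepFun_iff_map_prod_eq_prod_map_map (by fun_prop) (by fun_prop)] at *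
  rw [hAC, hBD, ← map_prod_prod_prod_comm, ← hAB, ← hCD, ← h, Measure.map_map (by fun_prop)
    (by fun_prop)]
  rfl

/-- The Borel σ-algebra of a space of continuous functions is generated by the evaluations. -/
theorem continuousMapMeasurableSpace_le_comap_coe {X E : Type*} [TopologicalSpace X]
    [CompactSpace X] [TopologicalSpace.SeparableSpace X] [PseudoMetricSpace E]
    [SecondCountableTopology C(X, E)] [MeasurableSpace E] [OpensMeasurableSpace E]
    [SecondCountableTopology E] :
    (continuousMapMeasurableSpace : MeasurableSpace C(X, E)) ≤
      MeasurableSpace.comap (fun f : C(X, E) => (f : X → E)) MeasurableSpace.pi := by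
  let m : MeasurableSpace C(X, E) :=
    MeasurableSpace.comap (fun f : C(X, E) => (f : X → E)) MeasurableSpace.pi
  have heval : ∀ x : X, Measurable[m] fun f : C(X, E) => f x := fun x =>
    (measurable_pi_apply x).comp (comap_measurable _)
  have hball : ∀ (f : C(X, E)) (r : ℝ), 0 ≤ r → MeasurableSet[m] (Metric.closedBall f r) := by
    intro f r hr
    obtain ⟨D, hDc, hD⟩ := TopologicalSpace.exists_countable_dense X
    -- By continuity, the sup distance is controlled by countably many evaluations.
    have : Metric.closedBall f r = ⋂ x ∈ D, {g : C(X, E) | dist (g x) (f x) ≤ r} := by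
      ext g
      simp only [Metric.mem_closedBall, ContinuousMap.dist_le hr, mem_iInter, mem_ofPred_eq]
      refine ⟨fun h x _ => h x, fun h x => ?_⟩
      have hcl : IsClosed {x | dist (g x) (f x) ≤ r} := isClosed_le (by fun_prop) continuous_const
      exact hcl.closure_subset_iff.2 (fun x hx => h x hx) (hD x)
    rw [this]
    exact .biInter hDc fun x _ => @measurableSet_le _ _ _ _ _ m _ _ _ _ _
      ((heval x).dist measurable_const) measurable_const
  refine MeasurableSpace.generateFrom_le fun U hU => ?_
  have hU' : ∀ f ∈ U, ∃ r > 0, Metric.closedBall f r ⊆ U := fun f hf =>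
    Metric.nhds_basis_closedBall.mem_iff.1 (IsOpen.mem_nhds hU hf)
  choose! r hr hrU using hU'
  -- Lindelöf: countably many of these closed balls cover the open set.
  obtain ⟨t, htU, htc, ht⟩ := TopologicalSpace.countable_cover_nhdsWithin
    (s := U) (f := fun f => Metric.closedBall f (r f))
    fun f hf => mem_nhdsWithin_of_mem_nhds (Metric.closedBall_mem_nhds f (hr f hf))
  have : U = ⋃ f ∈ t, Metric.closedBall f (r f) :=
    ht.antisymm (iUnion₂_subset fun f hf => hrU f (htU hf))
  rw [this]
  exact .biUnion htc fun f hf => hball f _ (hr f (htU hf)).le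

end Independence

/-! ### The Brownian bridge -/

section Bridge

/-- The bridge from `0` to `0` obtained from the path `r ↦ B (2 r)` on `[0, t]`, run on `[0, 1]`. -/
noncomputable def bridgePart (t : ℝ≥0) (B : C(ℝ≥0, ℂ)) : C(I, ℂ) where
  toFun s := B (2 * (t * unitInterval.toNNReal s)) - ((s : ℝ) : ℂ) * B (2 * t)
  continuous_toFun := by fun_prop

theorem bridgePart_apply (t : ℝ≥0) (B : C(ℝ≥0, ℂ)) (s : I) :
    bridgePart t B s = B (2 * (t * unitInterval.toNNReal s)) - ((s : ℝ) : ℂ) * B (2 * t) := rfl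

theorem continuous_bridgePart : Continuous fun p : ℝ≥0 × C(ℝ≥0, ℂ) => bridgePart p.1 p.2 := by
  refine ContinuousMap.continuous_of_continuous_uncurry _ ?_
  simp only [Function.uncurry_def, bridgePart_apply]
  fun_prop

theorem measurable_bridgePart (t : ℝ≥0) : Measurable (bridgePart t) := by
  have : Continuous (bridgePart t) := continuous_bridgePart.comp (by fun_prop : Continuous
    fun B : C(ℝ≥0, ℂ) => (t, B))
  exact this.measurable

/-- The covariance of the two sides is `min (2ts) (2t) - s * 2t = 0`, and they are jointly Gaussian.
-/
theorem ProbabilityTheory.IsPreBrownianReal.indepFun_bridge {Ω : Type*} [MeasurableSpace Ω]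
    {P : Measure Ω} {X : ℝ≥0 → Ω → ℝ} (hX : IsPreBrownianReal X P) (t : ℝ≥0) :
    IndepFun (fun ω (s : I) => X (2 * (t * unitInterval.toNNReal s)) ω - s * X (2 * t) ω)
      (X (2 * t)) P := by
  have mX u := hX.aemeasurable u
  -- The endpoint is treated as a process indexed by a single point, to fit the criterion for
  -- Gaussian processes.
  have key : IndepFun (fun ω (s : I) => X (2 * (t * unitInterval.toNNReal s)) ω - s * X (2 * t) ω)
      (fun ω (_ : Unit) => X (2 * t) ω) P := by
    apply IsGaussianProcess.indepFun_of_covariance_eq_zero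
    · apply hX.isGaussianProcess.of_isGaussianProcess
      rintro (s | _)
      · exact ⟨{2 * (t * unitInterval.toNNReal s), 2 * t},
          { toFun x := x ⟨2 * (t * unitInterval.toNNReal s), by simp⟩ - s * x ⟨2 * t, by simp⟩
            map_add' x y := by simp; ring
            map_smul' c x := by simp; ring }, by simp⟩
      · exact ⟨{2 * t},
          { toFun x := x ⟨2 * t, by simp⟩
            map_add' x y := by simp
            map_smul' c x := by simp }, by simp⟩
    any_goals fun_prop
    · intro s _
      have := hX.isGaussianProcess.isProbabilityMeasure
      have hle : 2 * (t * unitInterval.toNNReal s) ≤ 2 * t := by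
        have : unitInterval.toNNReal s ≤ 1 := s.2.2
        gcongr
        exact mul_le_of_le_one_right' this
      rw [covariance_fun_sub_left, covariance_const_mul_left, hX.covariance_eval,
        hX.covariance_eval, min_eq_left hle, min_self]
      · have : ((unitInterval.toNNReal s : ℝ≥0) : ℝ) = s := rfl
        push_cast
        rw [this]
        ring
      · exact (hX.isGaussianProcess.hasGaussianLaw_eval _).memLp_two
      · exact (hX.isGaussianProcess.hasGaussianLaw_eval _).memLp_two.const_mul _
      · exact (hX.isGaussianProcess.hasGaussianLaw_eval _).memLp_two
  exact key.comp measurable_id (measurable_pi_apply ())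

variable {P : Measure C(ℝ≥0, ℂ)}

theorem measurable_eval_continuousMap {X E : Type*} [TopologicalSpace X]
    [TopologicalSpace E] [MeasurableSpace E] [BorelSpace E] (x : X) :
    Measurable fun f : C(X, E) => f x :=
  (continuous_eval_const x).measurable

/-- The bridge part of a Brownian path is independent of its endpoint. -/
theorem IsPlanarBrownianLaw.indepFun_bridgePart [IsProbabilityMeasure P]
    (hP : IsPlanarBrownianLaw P) (t : ℝ≥0) :
    IndepFun (bridgePart t) (fun B => B (2 * t)) P := by
  have hev (u : ℝ≥0) : Measurable fun B : C(ℝ≥0, ℂ) => B u := measurable_eval_continuousMap u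
  have hre (u : ℝ≥0) : Measurable fun B : C(ℝ≥0, ℂ) => (B u).re :=
    Complex.measurable_re.comp (hev u)
  have him (u : ℝ≥0) : Measurable fun B : C(ℝ≥0, ℂ) => (B u).im :=
    Complex.measurable_im.comp (hev u)
  have h1 := hP.re.toIsPreBrownianReal.indepFun_bridge t
  have h2 := hP.im.toIsPreBrownianReal.indepFun_bridge t
  have hφ : Measurable fun f : ℝ≥0 → ℝ =>
      ((fun s : I => f (2 * (t * unitInterval.toNNReal s)) - s * f (2 * t)), f (2 * t)) := by
    fun_prop
  have h3 := indepFun_prodMk_prodMk_comm (by fun_prop) (hre _) (by fun_prop) (him _)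
    h1 h2 (hP.indep.comp hφ hφ)
  have h4 := h3.comp (φ := fun p (s : I) => (⟨p.1 s, p.2 s⟩ : ℂ))
    (ψ := fun p => (⟨p.1, p.2⟩ : ℂ))
    (measurable_pi_lambda _ fun s => Complex.measurableEquivRealProd.symm.measurable.comp
      (by fun_prop : Measurable fun p : (I → ℝ) × (I → ℝ) => (p.1 s, p.2 s)))
    Complex.measurableEquivRealProd.symm.measurable
  have h5 : IndepFun (fun B => (bridgePart t B : I → ℂ)) (fun B => B (2 * t)) P := by
    refine h4.congr (.of_forall fun B => ?_) (.of_forall fun B => rfl)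
    ext s
    apply Complex.ext <;> simp [bridgePart_apply]
  -- So far independence holds for the product σ-algebra on `I → ℂ`; it passes to the Borel
  -- σ-algebra of `C(I, ℂ)`, which evaluations generate.
  refine indep_of_indep_of_le_left h5 ?_
  refine (MeasurableSpace.comap_mono continuousMapMeasurableSpace_le_comap_coe).trans ?_
  rw [MeasurableSpace.comap_comp]
  rfl

/-- The coordinates at time `2t` are independent centred Gaussians of variance `2t`; the product of
their densities is the heat kernel of `Δ`. -/
theorem IsPlanarBrownianLaw.map_eval [IsProbabilityMeasure P]
    (hP : IsPlanarBrownianLaw P) {t : ℝ≥0} (ht : 0 < t) :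
    P.map (fun B => B (2 * t)) =
      volume.withDensity fun w => ENNReal.ofReal (heatKernel 0 w t) := by
  have hev (u : ℝ≥0) : Measurable fun B : C(ℝ≥0, ℂ) => B u := measurable_eval_continuousMap u
  have hre : Measurable fun B : C(ℝ≥0, ℂ) => (B (2 * t)).re := Complex.measurable_re.comp (hev _)
  have him : Measurable fun B : C(ℝ≥0, ℂ) => (B (2 * t)).im := Complex.measurable_im.comp (hev _)
  have hne : 2 * t ≠ 0 := by positivity
  have hind : IndepFun (fun B : C(ℝ≥0, ℂ) => (B (2 * t)).re) (fun B => (B (2 * t)).im) P :=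
    hP.indep.comp (measurable_pi_apply (2 * t)) (measurable_pi_apply (2 * t))
  rw [indepFun_iff_map_prod_eq_prod_map_map hre.aemeasurable him.aemeasurable,
    (hP.re.toIsPreBrownianReal.hasLaw_eval _).map_eq,
    (hP.im.toIsPreBrownianReal.hasLaw_eval _).map_eq, gaussianReal_of_var_ne_zero _ hne,
    prod_withDensity (by fun_prop) (by fun_prop)] at hind
  have hmeas : Measurable fun w => ENNReal.ofReal (heatKernel 0 w t) := by
    unfold heatKernel
    fun_prop
  refine Complex.measurableEquivRealProd.map_measurableEquiv_injective ?_
  rw [Measure.map_map (by fun_prop) (hev _)]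
  refine hind.trans (Measure.ext fun s hs => ?_)
  rw [withDensity_apply _ hs, MeasurableEquiv.map_apply, withDensity_apply _
    (Complex.measurableEquivRealProd.measurable hs), ← Measure.volume_eq_prod,
    ← Complex.volume_preserving_equiv_real_prod.setLIntegral_comp_preimage hs (by fun_prop)]
  refine lintegral_congr fun w => ?_
  have ht' : (0 : ℝ) < t := by exact_mod_cast ht
  rw [gaussianPDF, gaussianPDF, ← ENNReal.ofReal_mul (gaussianPDFReal_nonneg _ _ _)]
  congr 1
  simp only [gaussianPDFReal, Complex.measurableEquivRealProd_apply, heatKernel, sub_zero, zero_sub,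
    norm_neg, NNReal.coe_mul, NNReal.coe_ofNat]
  rw [mul_mul_mul_comm, ← Real.exp_add, ← mul_inv, Real.mul_self_sqrt (by positivity),
    ← Complex.normSq_eq_norm_sq, Complex.normSq_apply, one_div]
  congr 2 <;> ring

/-- Disintegration of planar Brownian motion with respect to its endpoint. -/
theorem IsPlanarBrownianLaw.lintegral_bridgePart [IsProbabilityMeasure P]
    (hP : IsPlanarBrownianLaw P) {t : ℝ≥0} (ht : 0 < t) {Φ : C(I, ℂ) × ℂ → ℝ≥0∞}
    (hΦ : Measurable Φ) :
    ∫⁻ B, Φ (bridgePart t B, B (2 * t)) ∂P =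
      ∫⁻ w, ENNReal.ofReal (heatKernel 0 w t) * ∫⁻ B, Φ (bridgePart t B, w) ∂P := by
  have hev : Measurable fun B : C(ℝ≥0, ℂ) => B (2 * t) := measurable_eval_continuousMap _
  have hb := measurable_bridgePart t
  have hmeas : Measurable fun w => ENNReal.ofReal (heatKernel 0 w t) := by
    unfold heatKernel
    fun_prop
  have h := (indepFun_iff_map_prod_eq_prod_map_map hb.aemeasurable hev.aemeasurable).1
    (hP.indepFun_bridgePart t)
  have : IsProbabilityMeasure (P.map (bridgePart t)) := Measure.isProbabilityMeasure_map
    hb.aemeasurable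
  rw [← lintegral_map (f := Φ) (g := fun B => (bridgePart t B, B (2 * t))) hΦ (hb.prodMk hev), h,
    hP.map_eval ht, lintegral_prod_symm _ hΦ.aemeasurable,
    lintegral_withDensity_eq_lintegral_mul _ hmeas hΦ.lintegral_prod_left']
  refine lintegral_congr fun w => ?_
  rw [Pi.mul_apply, lintegral_map (by fun_prop) hb]

end Bridge

/-! ### Heat kernel sums over a lattice -/

section HeatKernel

theorem heatKernel_nonneg (z w : ℂ) {t : ℝ} (ht : 0 ≤ t) : 0 ≤ heatKernel z w t := by
  unfold heatKernel; positivity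

theorem measurable_heatKernel (z : ℂ) : Measurable fun p : ℂ × ℝ => heatKernel z p.1 p.2 := by
  unfold heatKernel
  fun_prop

theorem continuous_heatKernel (z : ℂ) (t : ℝ) : Continuous fun w => heatKernel z w t := by
  unfold heatKernel
  fun_prop

/-- A bound of the heat kernel on the unit disk about `l` that is summable over lattices. -/
noncomputable def heatKernelBound (t : ℝ) (l : ℂ) : ℝ :=
  1 / (4 * Real.pi * t) * Real.exp (1 / (4 * t)) * Real.exp (-(1 / (8 * t)) * ‖l‖ ^ 2)

/-- From `‖l‖² ≤ 2‖l + w‖² + 2`: halving the Gaussian rate absorbs the shift by `w`, at the cost of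
the factor `exp (1 / 4t)`. -/
theorem heatKernel_add_le {t : ℝ} (ht : 0 < t) (l : ℂ) {w : ℂ} (hw : ‖w‖ ≤ 1) :
    heatKernel 0 (l + w) t ≤ heatKernelBound t l := by
  unfold heatKernel heatKernelBound
  rw [mul_assoc (1 / (4 * Real.pi * t)), ← Real.exp_add, zero_sub, norm_neg]
  have h : ‖l‖ ^ 2 ≤ 2 * ‖l + w‖ ^ 2 + 2 := by
    have h1 : ‖l‖ ≤ ‖l + w‖ + ‖w‖ := by simpa using norm_sub_le (l + w) w
    nlinarith [norm_nonneg l, norm_nonneg (l + w), norm_nonneg w, sq_nonneg (‖l + w‖ - ‖w‖)]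
  gcongr
  rw [div_le_iff₀ (by positivity)]
  have : (1 / (4 * t) + -(1 / (8 * t)) * ‖l‖ ^ 2) * (4 * t) = 1 - ‖l‖ ^ 2 / 2 := by
    field_simp
    ring
  rw [this]
  linarith

variable (Λ : Submodule ℤ ℂ) [DiscreteTopology Λ] [IsZLattice ℝ Λ]

/-- Comparison with `‖l‖⁻⁴`, which is summable since the rank 2 is less than 4. -/
theorem summable_exp_neg_mul_norm_sq {c : ℝ} (hc : 0 < c) :
    Summable fun l : Λ => Real.exp (-c * ‖(l : ℂ)‖ ^ 2) := by
  have hrank : Module.finrank ℤ Λ < 4 := by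
    rw [ZLattice.rank ℝ Λ, Complex.finrank_real_complex]
    norm_num
  refine Summable.of_norm_bounded_eventually
    ((ZLattice.summable_norm_pow_inv Λ 4 hrank).mul_left (2 / c ^ 2)) ?_
  -- The origin is set aside: there the comparison term is `0⁻¹ ^ 4 = 0` and the bound fails.
  refine (Set.finite_singleton (0 : Λ)).subset fun l hl => ?_
  by_contra h0
  refine hl ?_
  have hl0 : 0 < ‖(l : ℂ)‖ := by
    rw [norm_pos_iff]
    exact fun h => h0 (Subtype.ext h)
  rw [mem_ofPred_eq, Real.norm_eq_abs, Real.abs_exp, neg_mul, Real.exp_neg]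
  have hq := Real.quadratic_le_exp_of_nonneg (x := c * ‖(l : ℂ)‖ ^ 2) (by positivity)
  have hle : c ^ 2 * ‖(l : ℂ)‖ ^ 4 / 2 ≤ Real.exp (c * ‖(l : ℂ)‖ ^ 2) := by
    have : 0 ≤ c * ‖(l : ℂ)‖ ^ 2 := by positivity
    nlinarith
  calc (Real.exp (c * ‖(l : ℂ)‖ ^ 2))⁻¹ ≤ (c ^ 2 * ‖(l : ℂ)‖ ^ 4 / 2)⁻¹ := by gcongr
    _ = 2 / c ^ 2 * ‖l‖⁻¹ ^ 4 := by
      rw [Submodule.coe_norm]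
      field_simp

theorem tsum_heatKernelBound_ne_top {t : ℝ} (ht : 0 < t) :
    ∑' l : Λ, ENNReal.ofReal (heatKernelBound t l) ≠ ∞ :=
  ((summable_exp_neg_mul_norm_sq Λ (c := 1 / (8 * t)) (by positivity)).mul_left _).tsum_ofReal_ne_top

theorem tsum_ofReal_heatKernel_ne_top {t : ℝ} (ht : 0 < t) :
    ∑' l : Λ, ENNReal.ofReal (heatKernel 0 l t) ≠ ∞ := by
  refine ne_top_of_le_ne_top (tsum_heatKernelBound_ne_top Λ ht) (ENNReal.tsum_le_tsum fun l => ?_)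
  simpa using ENNReal.ofReal_le_ofReal (heatKernel_add_le ht (l : ℂ) (w := 0) (by simp))

end HeatKernel

/-! ### Averages on small sets -/

/-- If `H` tends to `c` uniformly on the sets `S i`, then so do its averages on these sets. -/
theorem tendsto_inv_measure_mul_setLIntegral {X ι : Type*} [MeasurableSpace X] {μ : Measure X}
    {L : Filter ι} {S : ι → Set X} (hS : ∀ i, MeasurableSet (S i))
    (h0 : ∀ᶠ i in L, μ (S i) ≠ 0) (htop : ∀ᶠ i in L, μ (S i) ≠ ∞)
    {H : X → ℝ≥0∞} {c : ℝ≥0∞} (hH : ∀ U ∈ 𝓝 c, ∀ᶠ i in L, ∀ x ∈ S i, H x ∈ U) :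
    Tendsto (fun i => (μ (S i))⁻¹ * ∫⁻ x in S i, H x ∂μ) L (𝓝 c) := by
  refine tendsto_order.2 ⟨fun a ha => ?_, fun a ha => ?_⟩
  · obtain ⟨b, hab, hbc⟩ := exists_between ha
    filter_upwards [h0, htop, hH _ (lt_mem_nhds hbc)] with i hi0 hitop hi
    refine hab.trans_le ?_
    calc b = (μ (S i))⁻¹ * (b * μ (S i)) := by
          rw [mul_left_comm, ENNReal.inv_mul_cancel hi0 hitop, mul_one]
      _ = (μ (S i))⁻¹ * ∫⁻ _ in S i, b ∂μ := by rw [setLIntegral_const]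
      _ ≤ _ := by
        gcongr 1
        exact setLIntegral_mono' (hS i) fun x hx => (hi x hx).le
  · obtain ⟨b, hcb, hba⟩ := exists_between ha
    filter_upwards [h0, htop, hH _ (gt_mem_nhds hcb)] with i hi0 hitop hi
    refine lt_of_le_of_lt ?_ hba
    calc _ ≤ (μ (S i))⁻¹ * ∫⁻ _ in S i, b ∂μ := by
          gcongr 1
          exact setLIntegral_mono' (hS i) fun x hx => (hi x hx).le
      _ = (μ (S i))⁻¹ * (b * μ (S i)) := by rw [setLIntegral_const]
      _ = b := by rw [mul_left_comm, ENNReal.inv_mul_cancel hi0 hitop, mul_one]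

/-! ### Volume of the torus -/

section Volume

variable (Λ : Submodule ℤ ℂ)

theorem lattice_vadd_eq (l : Λ) (z : ℂ) : l +ᵥ z = (l : ℂ) + z := rfl

theorem torusMk_lattice_vadd (l : Λ) (z : ℂ) : torusMk Λ (l +ᵥ z) = torusMk Λ z := by
  rw [lattice_vadd_eq, torusMk_add, torusMk_eq_zero.2 l.2, zero_add]

instance : MeasurableConstVAdd Λ ℂ := ⟨fun l => measurable_const_add (l : ℂ)⟩

instance : VAddInvariantMeasure Λ ℂ volume :=
  ⟨fun l s _ => measure_preimage_add volume (l : ℂ) s⟩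

variable [DiscreteTopology Λ] [IsZLattice ℝ Λ]

/-- The fundamental parallelogram used to define the volume of the torus. -/
abbrev latticeDomain : Set ℂ :=
  ZSpan.fundamentalDomain ((Module.Free.chooseBasis ℤ Λ).ofZLatticeBasis ℝ Λ)

theorem isAddFundamentalDomain_latticeDomain :
    IsAddFundamentalDomain Λ (latticeDomain Λ) (volume : Measure ℂ) :=
  ZLattice.isAddFundamentalDomain _ _

theorem torusVolume_apply {s : Set (FlatTorus Λ)} (hs : MeasurableSet s) :
    torusVolume Λ s = (volume.restrict (latticeDomain Λ)) (torusMk Λ ⁻¹' s) :=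
  Measure.map_apply measurable_torusMk hs

theorem torusVolume_univ : torusVolume Λ univ = volume (latticeDomain Λ) := by
  rw [torusVolume_apply Λ .univ, preimage_univ, Measure.restrict_apply_univ]

instance : IsFiniteMeasure (torusVolume Λ) := by
  refine ⟨?_⟩
  rw [torusVolume_univ]
  exact (ZSpan.fundamentalDomain_isBounded _).measure_lt_top

/-- The preimage in the plane is open and `Λ`-invariant; were it null in one fundamental domain, it
would be null everywhere. -/
theorem torusVolume_pos_of_isOpen {s : Set (FlatTorus Λ)} (hs : IsOpen s) (hne : s.Nonempty) :
    torusVolume Λ s ≠ 0 := by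
  have ho : IsOpen (torusMk Λ ⁻¹' s) := hs.preimage (continuous_torusMk Λ)
  rw [torusVolume_apply Λ hs.measurableSet, Measure.restrict_apply ho.measurableSet]
  intro h
  refine (ho.measure_pos volume (hne.preimage torusMk_surjective)).ne'
    ((isAddFundamentalDomain_latticeDomain Λ).measure_zero_of_invariant _ (fun l => ?_) h)
  ext z
  rw [mem_vadd_set_iff_neg_vadd_mem, mem_preimage, torusMk_lattice_vadd, mem_preimage]

end Volume

/-! ### The bridge measures of the torus -/

section TorusBridge

variable {Λ : Submodule ℤ ℂ}

/-- The path on the torus from `x` that follows `b` with an added drift `w`. -/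
noncomputable def driftPath (x : FlatTorus Λ) (w : ℂ) (b : C(I, ℂ)) : C(I, FlatTorus Λ) where
  toFun s := x + torusMk Λ (b s + ((s : ℝ) : ℂ) * w)
  continuous_toFun := by
    have := continuous_torusMk Λ
    fun_prop

theorem driftPath_apply (x : FlatTorus Λ) (w : ℂ) (b : C(I, ℂ)) (s : I) :
    driftPath x w b s = x + torusMk Λ (b s + ((s : ℝ) : ℂ) * w) := rfl

theorem continuous_driftPath :
    Continuous fun p : FlatTorus Λ × ℂ × C(I, ℂ) => driftPath p.1 p.2.1 p.2.2 := by
  have := continuous_torusMk Λ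
  refine ContinuousMap.continuous_of_continuous_uncurry _ ?_
  simp only [Function.uncurry_def, driftPath_apply]
  fun_prop

theorem continuous_driftPath_right (x : FlatTorus Λ) :
    Continuous fun p : ℂ × C(I, ℂ) => driftPath x p.1 p.2 :=
  continuous_driftPath.comp (by fun_prop : Continuous fun p : ℂ × C(I, ℂ) => (x, p))

theorem torusPath_eq_driftPath (t : ℝ≥0) (x : FlatTorus Λ) (B : C(ℝ≥0, ℂ)) :
    torusPath t x B = driftPath x (B (2 * t)) (bridgePart t B) := by
  ext s
  rw [driftPath_apply, bridgePart_apply, sub_add_cancel]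
  rfl

theorem torusPath_apply_one (t : ℝ≥0) (x : FlatTorus Λ) (B : C(ℝ≥0, ℂ)) :
    torusPath t x B 1 = x + torusMk Λ (B (2 * t)) := by
  have : unitInterval.toNNReal 1 = 1 := rfl
  change x + torusMk Λ (B (2 * (t * unitInterval.toNNReal 1))) = _
  rw [this, mul_one]

theorem continuous_torusPath (t : ℝ≥0) (x : FlatTorus Λ) : Continuous (torusPath t x) := by
  have := continuous_torusMk Λ
  refine ContinuousMap.continuous_of_continuous_uncurry _ ?_
  change Continuous fun p : C(ℝ≥0, ℂ) × I =>
    x + torusMk Λ (p.1 (2 * (t * unitInterval.toNNReal p.2)))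
  fun_prop

/-- The sum over the lattice of the laws of the projections of Brownian bridges from a lift `z` of
`x` to `z + l`, weighted by the heat kernel. -/
noncomputable def latticeBridge (P : Measure C(ℝ≥0, ℂ)) (t : ℝ≥0) (x : FlatTorus Λ) :
    Measure C(I, FlatTorus Λ) :=
  Measure.sum fun l : Λ => ENNReal.ofReal (heatKernel 0 l t) •
    P.map fun B => driftPath x l (bridgePart t B)

theorem measurable_driftPath_bridgePart (t : ℝ≥0) (x : FlatTorus Λ) (w : ℂ) :
    Measurable fun B : C(ℝ≥0, ℂ) => driftPath x w (bridgePart t B) :=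
  (((continuous_driftPath_right x).comp (by fun_prop : Continuous fun b : C(I, ℂ) =>
    (w, b))).measurable).comp (measurable_bridgePart t)

theorem lintegral_latticeBridge [DiscreteTopology Λ] [IsZLattice ℝ Λ] (P : Measure C(ℝ≥0, ℂ))
    (t : ℝ≥0) (x : FlatTorus Λ) {f : C(I, FlatTorus Λ) → ℝ≥0∞} (hf : Measurable f) :
    ∫⁻ W, f W ∂latticeBridge P t x = ∑' l : Λ, ENNReal.ofReal (heatKernel 0 l t) *
      ∫⁻ B, f (driftPath x l (bridgePart t B)) ∂P := by
  rw [latticeBridge, lintegral_sum_measure]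
  refine tsum_congr fun l => ?_
  rw [lintegral_smul_measure, lintegral_map hf (measurable_driftPath_bridgePart t x l), smul_eq_mul]

theorem continuous_lintegral_driftPath (P : Measure C(ℝ≥0, ℂ)) [IsProbabilityMeasure P] (t : ℝ≥0)
    (x : FlatTorus Λ) (f : BoundedContinuousFunction C(I, FlatTorus Λ) ℝ≥0) :
    Continuous fun w => ∫⁻ B, f (driftPath x w (bridgePart t B)) ∂P := by
  refine continuous_iff_continuousAt.2 fun w => ?_
  refine tendsto_lintegral_filter_of_dominated_convergence (fun _ => (nndist f 0 : ℝ≥0∞))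
    (.of_forall fun w' => ?_) (.of_forall fun w' => .of_forall fun B => ?_) ?_
    (.of_forall fun B => ?_)
  · exact (f.continuous.measurable.comp (measurable_driftPath_bridgePart t x w')).coe_nnreal_ennreal
  · exact_mod_cast BoundedContinuousFunction.NNReal.upper_bound f _
  · simp
  · have h : Continuous fun w => f (driftPath x w (bridgePart t B)) :=
      f.continuous.comp ((continuous_driftPath_right x).comp (by fun_prop : Continuous
        fun w : ℂ => (w, bridgePart t B)))
    exact (ENNReal.continuous_coe.comp h).tendsto w

/-- Disintegration over the endpoint `w = B (2t)`: the event of ending in `s` depends on `w` alone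
and leaves the inner integral. -/
theorem lintegral_torusBrownian_restrict {P : ProbabilityMeasure C(ℝ≥0, ℂ)}
    (hP : IsPlanarBrownianLaw (P : Measure C(ℝ≥0, ℂ))) {t : ℝ≥0} (ht : 0 < t)
    (x : FlatTorus Λ) {f : C(I, FlatTorus Λ) → ℝ≥0∞} (hf : Measurable f)
    {s : Set (FlatTorus Λ)} (hs : IsOpen s) :
    ∫⁻ W, f W ∂((torusBrownian P t x).restrict {W | W 1 ∈ s} : Measure C(I, FlatTorus Λ)) =
      ∫⁻ w, s.indicator 1 (x + torusMk Λ w) * (ENNReal.ofReal (heatKernel 0 w t) *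
        ∫⁻ B, f (driftPath x w (bridgePart t B)) ∂(P : Measure C(ℝ≥0, ℂ))) := by
  have hS : MeasurableSet {W : C(I, FlatTorus Λ) | W 1 ∈ s} :=
    (hs.preimage (continuous_eval_const 1)).measurableSet
  have hind : Measurable fun w => s.indicator (1 : FlatTorus Λ → ℝ≥0∞) (x + torusMk Λ w) :=
    measurable_one.indicator (hs.preimage ((continuous_torusMk Λ).const_add x)).measurableSet
  have hdrift : Measurable fun p : C(I, ℂ) × ℂ => driftPath x p.2 p.1 :=
    ((continuous_driftPath_right x).comp continuous_swap).measurable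
  rw [FiniteMeasure.restrict_measure_eq, ← lintegral_indicator hS, torusBrownian,
    FiniteMeasure.toMeasure_map, lintegral_map (hf.indicator hS)
      (continuous_torusPath t x).measurable]
  have h := hP.lintegral_bridgePart ht (Φ := fun p =>
    s.indicator 1 (x + torusMk Λ p.2) * f (driftPath x p.2 p.1))
    ((hind.comp measurable_snd).mul (hf.comp hdrift))
  refine Eq.trans (lintegral_congr fun B => ?_) (h.trans (lintegral_congr fun w => ?_))
  · rw [← torusPath_eq_driftPath, ← torusPath_apply_one]
    by_cases hB : torusPath t x B 1 ∈ s <;> simp [hB]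
  · have : Measurable fun B => f (driftPath x w (bridgePart t B)) :=
      hf.comp (measurable_driftPath_bridgePart t x w)
    rw [← mul_left_comm]
    exact congrArg _ (lintegral_const_mul (s.indicator 1 (x + torusMk Λ w)) this)

variable [DiscreteTopology Λ] [IsZLattice ℝ Λ]

theorem isFiniteMeasure_latticeBridge (P : Measure C(ℝ≥0, ℂ)) [IsProbabilityMeasure P] {t : ℝ≥0}
    (ht : 0 < t) (x : FlatTorus Λ) : IsFiniteMeasure (latticeBridge P t x) := by
  refine ⟨?_⟩
  have := lintegral_latticeBridge P t x measurable_one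
  simp only [Pi.one_apply, lintegral_one, measure_univ, mul_one] at this
  rw [this]
  exact (tsum_ofReal_heatKernel_ne_top Λ (by exact_mod_cast ht)).lt_top

/-- Dominated convergence for the counting measure on `Λ`, with `heatKernelBound` as dominating
function for `‖w‖ ≤ 1`. -/
theorem tendsto_tsum_heatKernel_mul {t : ℝ} (ht : 0 < t) {F : ℂ → ℝ≥0∞} (hF : Continuous F)
    {M : ℝ≥0} (hM : ∀ w, F w ≤ M) :
    Tendsto (fun w => ∑' l : Λ, ENNReal.ofReal (heatKernel 0 (l + w) t) * F (l + w)) (𝓝 0)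
      (𝓝 (∑' l : Λ, ENNReal.ofReal (heatKernel 0 l t) * F l)) := by
  let _ : MeasurableSpace Λ := ⊤
  have _ : MeasurableSingletonClass Λ := ⟨fun _ => trivial⟩
  simp only [← lintegral_count]
  refine tendsto_lintegral_filter_of_dominated_convergence
    (fun l : Λ => ENNReal.ofReal (heatKernelBound t l) * M) (.of_forall fun _ => fun _ _ => trivial)
    ?_ ?_ (.of_forall fun l => ?_)
  · filter_upwards [Metric.closedBall_mem_nhds (0 : ℂ) one_pos] with w hw
    refine .of_forall fun l => ?_
    gcongr
    · exact heatKernel_add_le ht _ (by simpa using hw)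
    · exact hM _
  · rw [lintegral_count, ENNReal.tsum_mul_right]
    exact ENNReal.mul_ne_top (tsum_heatKernelBound_ne_top Λ ht) ENNReal.coe_ne_top
  · have h1 : Tendsto (fun w => heatKernel 0 (l + w) t) (𝓝 0) (𝓝 (heatKernel 0 l t)) :=
      ((continuous_heatKernel 0 t).comp (continuous_const_add (l : ℂ))).tendsto' _ _ (by simp)
    have h2 : Tendsto (fun w => F (l + w)) (𝓝 0) (𝓝 (F l)) :=
      (hF.comp (continuous_const_add (l : ℂ))).tendsto' _ _ (by simp)
    exact ENNReal.Tendsto.mul (ENNReal.tendsto_ofReal h1) (.inr (ne_top_of_le_ne_top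
      ENNReal.coe_ne_top (hM _))) h2 (.inr ENNReal.ofReal_ne_top)

/-- Unfolding of an integral over the plane to an integral over a fundamental parallelogram. -/
theorem lintegral_indicator_torusMk {g : ℂ → ℝ≥0∞} (hg : Measurable g) {s : Set (FlatTorus Λ)}
    (hs : MeasurableSet s) (z : ℂ) :
    ∫⁻ w, (torusMk Λ ⁻¹' s).indicator 1 (z + w) * g w =
      ∫⁻ w in torusMk Λ ⁻¹' s, ∑' l : Λ, g (l + (w - z))
        ∂(volume.restrict (latticeDomain Λ)) := by
  have hs' : MeasurableSet (torusMk Λ ⁻¹' s) := measurable_torusMk hs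
  -- After the shift by `z` the indicator is `Λ`-invariant and factors out of the lattice sum.
  rw [← lintegral_sub_right_eq_self _ z,
    (isAddFundamentalDomain_latticeDomain Λ).lintegral_eq_tsum'', ← lintegral_tsum,
    ← lintegral_indicator hs']
  · refine lintegral_congr fun w => ?_
    have hw (l : Λ) : (torusMk Λ ⁻¹' s).indicator (1 : ℂ → ℝ≥0∞) (z + ((l +ᵥ w) - z)) =
        (torusMk Λ ⁻¹' s).indicator 1 w := by
      rw [add_sub_cancel z (l +ᵥ w)]
      have hiff : l +ᵥ w ∈ torusMk Λ ⁻¹' s ↔ w ∈ torusMk Λ ⁻¹' s := by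
        rw [mem_preimage, torusMk_lattice_vadd, mem_preimage]
      by_cases h : w ∈ torusMk Λ ⁻¹' s
      · rw [indicator_of_mem h, indicator_of_mem (hiff.2 h)]
        rfl
      · rw [indicator_of_notMem h, indicator_of_notMem (mt hiff.1 h)]
    simp only [hw]
    rw [ENNReal.tsum_mul_left]
    simp only [lattice_vadd_eq, add_sub_assoc]
    by_cases h : w ∈ torusMk Λ ⁻¹' s <;> simp [h]
  · intro l
    have : Measurable fun w : ℂ => l +ᵥ w := measurable_const_vadd l
    have h1 : Measurable ((torusMk Λ ⁻¹' s).indicator (1 : ℂ → ℝ≥0∞)) :=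
      measurable_one.indicator hs'
    fun_prop

/-- Tested on `f`, each measure is the average, over the part of a fundamental domain above the
disk, of a continuous lattice sum in the endpoint; the averages tend to its value at zero
displacement. -/
theorem tendsto_torusBridge {P : ProbabilityMeasure C(ℝ≥0, ℂ)}
    (hP : IsPlanarBrownianLaw (P : Measure C(ℝ≥0, ℂ))) {t : ℝ≥0} (ht : 0 < t)
    (x : FlatTorus Λ) :
    Tendsto (fun ε : ℝ => ((torusVolume Λ (Metric.ball x ε)).toNNReal)⁻¹ •
      (torusBrownian P t x).restrict {W | W 1 ∈ Metric.ball x ε}) (𝓝[>] 0)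
      (𝓝 ⟨latticeBridge P t x, isFiniteMeasure_latticeBridge _ ht x⟩) := by
  refine FiniteMeasure.tendsto_iff_forall_lintegral_tendsto.2 fun f => ?_
  have ht' : (0 : ℝ) < t := by exact_mod_cast ht
  obtain ⟨z, rfl⟩ := torusMk_surjective x
  have hf : Measurable fun W => (f W : ℝ≥0∞) := f.continuous.measurable.coe_nnreal_ennreal
  set F : ℂ → ℝ≥0∞ := fun w => ∫⁻ B, f (driftPath (torusMk Λ z) w (bridgePart t B))
    ∂(P : Measure C(ℝ≥0, ℂ)) with hF
  have hFc : Continuous F := continuous_lintegral_driftPath _ t _ f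
  have hFM : ∀ w, F w ≤ (nndist f 0 : ℝ≥0) := fun w => by
    refine (lintegral_mono fun B => ENNReal.coe_le_coe.2
      (BoundedContinuousFunction.NNReal.upper_bound f _)).trans ?_
    simp
  have hg : Measurable fun w => ENNReal.ofReal (heatKernel 0 w t) * F w :=
    (continuous_heatKernel 0 t).measurable.ennreal_ofReal.mul hFc.measurable
  have hG := tendsto_tsum_heatKernel_mul (Λ := Λ) ht' hFc hFM
  have hlim : ∫⁻ W, f W ∂(latticeBridge P t (torusMk Λ z)) =
      ∑' l : Λ, ENNReal.ofReal (heatKernel 0 l t) * F l := lintegral_latticeBridge _ t _ hf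
  have hvol0 : ∀ ε > 0, torusVolume Λ (Metric.ball (torusMk Λ z) ε) ≠ 0 := fun ε hε =>
    torusVolume_pos_of_isOpen Λ Metric.isOpen_ball ⟨_, Metric.mem_ball_self hε⟩
  have hball (ε : ℝ) : MeasurableSet (Metric.ball (torusMk Λ z) ε) :=
    Metric.isOpen_ball.measurableSet
  have hkey := tendsto_inv_measure_mul_setLIntegral (L := 𝓝[>] (0 : ℝ))
    (μ := volume.restrict (latticeDomain Λ))
    (S := fun ε => torusMk Λ ⁻¹' Metric.ball (torusMk Λ z) ε)
    (fun ε => measurable_torusMk (hball ε))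
    (by
      filter_upwards [self_mem_nhdsWithin] with ε hε
      rw [← torusVolume_apply Λ (hball ε)]
      exact hvol0 ε hε)
    (.of_forall fun ε => by
      rw [← torusVolume_apply Λ (hball ε)]
      exact measure_ne_top _ _)
    (H := fun w => ∑' l : Λ, ENNReal.ofReal (heatKernel 0 (l + (w - z)) t) * F (l + (w - z)))
    (c := ∑' l : Λ, ENNReal.ofReal (heatKernel 0 l t) * F l)
    (by
      -- The preimage of a small disk in the parallelogram need not lie near `z`. But the lattice
      -- sum is `Λ`-periodic, and since the projection is open each point `w` over the disk has a
      -- translate `w'` close to `z`; reindexing by `w - w'` compares the sums.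
      intro U hU
      have h1 : ∀ᶠ w in 𝓝 z, ∑' l : Λ, ENNReal.ofReal (heatKernel 0 (l + (w - z)) t) *
          F (l + (w - z)) ∈ U :=
        ((continuous_sub_right z).tendsto' z 0 (sub_self z)).eventually (hG.eventually_mem hU)
      have h2 := isOpenMap_torusMk.image_mem_nhds (f := torusMk Λ) h1
      obtain ⟨r, hr, hrU⟩ := Metric.mem_nhds_iff.1 h2
      filter_upwards [Ioo_mem_nhdsGT hr] with ε hε w hw
      obtain ⟨w', hw', hww'⟩ := hrU (Metric.ball_subset_ball hε.2.le hw)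
      have hmem : w - w' ∈ Λ := by rw [← torusMk_eq_zero, torusMk_sub, hww', sub_self]
      rw [mem_ofPred_eq] at hw'
      convert hw' using 1
      refine Eq.trans (tsum_congr fun l => ?_) ((Equiv.addRight (⟨w - w', hmem⟩ : Λ)).tsum_eq
        fun l : Λ => ENNReal.ofReal (heatKernel 0 (l + (w' - z)) t) * F (l + (w' - z)))
      have : (l : ℂ) + (w - z) = ((Equiv.addRight (⟨w - w', hmem⟩ : Λ) l : Λ) : ℂ) + (w' - z) := by
        simp only [Equiv.coe_addRight, Submodule.coe_add]
        ring
      rw [this])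
  rw [FiniteMeasure.toMeasure_mk, hlim]
  refine hkey.congr' ?_
  filter_upwards [self_mem_nhdsWithin] with ε hε
  rw [FiniteMeasure.toMeasure_smul, lintegral_smul_measure, ENNReal.smul_def, smul_eq_mul,
    ENNReal.coe_inv (ENNReal.toNNReal_ne_zero.2 ⟨hvol0 ε hε, measure_ne_top _ _⟩),
    ENNReal.coe_toNNReal (measure_ne_top _ _), torusVolume_apply Λ (hball ε),
    lintegral_torusBrownian_restrict hP ht _ hf Metric.isOpen_ball,
    ← lintegral_indicator_torusMk hg (hball ε) z]
  rfl

theorem torusBridge_eq {P : ProbabilityMeasure C(ℝ≥0, ℂ)}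
    (hP : IsPlanarBrownianLaw (P : Measure C(ℝ≥0, ℂ))) {t : ℝ≥0} (ht : 0 < t)
    (x : FlatTorus Λ) : (torusBridge P t x x : Measure C(I, FlatTorus Λ)) = latticeBridge P t x := by
  rw [torusBridge, (tendsto_torusBridge hP ht x).limUnder_eq]
  rfl

end TorusBridge

/-! ### The class of the projection of a bridge -/

section CircleLoop

variable {Λ : Submodule ℤ ℂ}

theorem circleLoop_coe (W : C(I, FlatTorus Λ)) (h : W 0 = W 1) {s : ℝ} (hs : s ∈ Ico (0 : ℝ) 1) :
    circleLoop W h (s : AddCircle (1 : ℝ)) = W ⟨s, hs.1, hs.2.le⟩ := by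
  have hs' : s ∈ Ico (0 : ℝ) (0 + 1) := by rwa [zero_add]
  change AddCircle.liftIco 1 0 (IccExtend zero_le_one W) (s : AddCircle (1 : ℝ)) = _
  rw [AddCircle.liftIco_coe_apply hs', IccExtend_of_mem _ _ ⟨hs.1, hs.2.le⟩]

theorem AddCircle.exists_coe_eq_mem_Ico (s : AddCircle (1 : ℝ)) :
    ∃ u ∈ Ico (0 : ℝ) 1, (u : AddCircle (1 : ℝ)) = s := by
  have : s ∈ ((↑) : ℝ → AddCircle (1 : ℝ)) '' Ico 0 (0 + 1) := by
    rw [AddCircle.coe_image_Ico_eq]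
    trivial
  simpa using this

theorem continuous_circleLoop : Continuous fun W : {W : C(I, FlatTorus Λ) // W 0 = W 1} =>
    circleLoop W.1 W.2 := by
  have : LipschitzWith (α := {W : C(I, FlatTorus Λ) // W 0 = W 1})
      (β := C(AddCircle (1 : ℝ), FlatTorus Λ)) 1 fun W => circleLoop W.1 W.2 := by
    refine LipschitzWith.of_dist_le_mul (α := {W : C(I, FlatTorus Λ) // W 0 = W 1})
      (β := C(AddCircle (1 : ℝ), FlatTorus Λ)) fun W W' => ?_
    rw [NNReal.coe_one, one_mul, ContinuousMap.dist_le dist_nonneg]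
    intro s
    obtain ⟨u, hu, rfl⟩ := AddCircle.exists_coe_eq_mem_Ico s
    rw [circleLoop_coe _ _ hu, circleLoop_coe _ _ hu]
    exact ContinuousMap.dist_apply_le_dist (f := W.1) (g := W'.1) _
  exact this.continuous

/-- The duration of a loop and its trajectory on `[0, 1]`. -/
def ParametrizedLoop.val (p : ParametrizedLoop Λ) : ℝ × C(I, FlatTorus Λ) := Subtype.val p

theorem measurable_toUnrooted : Measurable (ParametrizedLoop.toUnrooted (Λ := Λ)) := by
  have h1 : Measurable fun p : ParametrizedLoop Λ =>
      (⟨p.1.2, p.2.2⟩ : {W : C(I, FlatTorus Λ) // W 0 = W 1}) :=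
    Measurable.subtype_mk (measurable_snd.comp measurable_subtype_coe)
  have h2 : Continuous (Y := UnrootedLoop Λ) fun W : {W : C(I, FlatTorus Λ) // W 0 = W 1} =>
      Quotient.mk (loopSetoid Λ) (circleLoop W.1 W.2) :=
    continuous_quot_mk.comp continuous_circleLoop
  exact h2.measurable.comp h1

/-- Since `b` closes up it extends periodically to `g`, and `z + g s + s * l` is a lift with
displacement `l`; over the integer part of `s` the drift is a lattice vector. -/
theorem circleLoop_driftPath_mem_windingClass {l : ℂ} (hl : l ∈ Λ) (x : FlatTorus Λ) (b : C(I, ℂ))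
    (hb : b 0 = b 1) (h : driftPath x l b 0 = driftPath x l b 1) :
    circleLoop (driftPath x l b) h ∈ windingClass Λ l := by
  obtain ⟨z, rfl⟩ := torusMk_surjective x
  let g : AddCircle (1 : ℝ) → ℂ := AddCircle.liftIco 1 0 (IccExtend zero_le_one b)
  have hg : Continuous g := by
    refine AddCircle.liftIco_zero_continuous ?_ ?_
    · rw [IccExtend_left, IccExtend_right]
      exact hb
    · exact b.continuous.Icc_extend'.continuousOn
  refine ⟨⟨fun s => z + g (s : AddCircle (1 : ℝ)) + s * l, ?_⟩, fun s => ?_, fun s => ?_⟩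
  · have := AddCircle.continuous_mk' (1 : ℝ)
    have : Continuous fun s : ℝ => g (s : AddCircle (1 : ℝ)) := hg.comp this
    fun_prop
  · have hu : Int.fract s ∈ Ico (0 : ℝ) 1 := ⟨Int.fract_nonneg s, Int.fract_lt_one s⟩
    have hs : (s : AddCircle (1 : ℝ)) = (Int.fract s : ℝ) := by
      refine QuotientAddGroup.eq.2 ⟨-⌊s⌋, ?_⟩
      simp [← Int.self_sub_floor, sub_eq_neg_add]
    have hgs : g (Int.fract s : ℝ) = b ⟨Int.fract s, hu.1, hu.2.le⟩ := by
      have hs' : Int.fract s ∈ Ico (0 : ℝ) (0 + 1) := by rwa [zero_add]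
      change AddCircle.liftIco 1 0 (IccExtend zero_le_one b)
        ((Int.fract s : ℝ) : AddCircle (1 : ℝ)) = _
      rw [AddCircle.liftIco_coe_apply hs', IccExtend_of_mem _ _ ⟨hu.1, hu.2.le⟩]
    have hfl : torusMk Λ ((⌊s⌋ : ℂ) * l) = 0 := by
      rw [torusMk_eq_zero, ← zsmul_eq_mul]
      exact Λ.smul_mem _ hl
    have hsl : ((s : ℝ) : ℂ) * l = (⌊s⌋ : ℂ) * l + ((Int.fract s : ℝ) : ℂ) * l := by
      rw [← add_mul]
      congr 1
      exact_mod_cast (Int.floor_add_fract s).symm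
    simp only [ContinuousMap.coe_mk]
    rw [hs, circleLoop_coe _ _ hu, driftPath_apply, hgs, hsl, add_assoc z, torusMk_add z,
      add_left_comm, torusMk_add ((⌊s⌋ : ℂ) * l), hfl, zero_add]
  · simp only [ContinuousMap.coe_mk, AddCircle.coe_add_period, Complex.ofReal_add,
      Complex.ofReal_one]
    ring

theorem bridgePart_apply_one (t : ℝ≥0) (B : C(ℝ≥0, ℂ)) : bridgePart t B 1 = 0 := by
  have : unitInterval.toNNReal 1 = 1 := rfl
  simp [bridgePart_apply, this]

theorem bridgePart_apply_zero (t : ℝ≥0) (B : C(ℝ≥0, ℂ)) : bridgePart t B 0 = B 0 := by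
  have : unitInterval.toNNReal 0 = 0 := rfl
  simp [bridgePart_apply, this]

end CircleLoop

/-- `bridgePart t B` starts at `B 0`, so it closes up only almost surely. -/
theorem IsPlanarBrownianLaw.ae_apply_zero {P : Measure C(ℝ≥0, ℂ)} (hP : IsPlanarBrownianLaw P) :
    ∀ᵐ B ∂P, B 0 = 0 := by
  filter_upwards [hP.re.toIsPreBrownianReal.eval_zero_ae_eq_zero,
    hP.im.toIsPreBrownianReal.eval_zero_ae_eq_zero] with B h1 h2
  exact Complex.ext h1 h2

/-! ### The measure of a free homotopy class -/

section LoopMeasure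

variable {Λ : Submodule ℤ ℂ} [DiscreteTopology Λ]

theorem measurableEmbedding_parametrizedLoop :
    MeasurableEmbedding (ParametrizedLoop.val : ParametrizedLoop Λ → ℝ × C(I, FlatTorus Λ)) := by
  refine MeasurableEmbedding.subtype_coe ?_
  have h1 : MeasurableSet {W : C(I, FlatTorus Λ) | W 0 = W 1} :=
    (isClosed_eq (continuous_eval_const 0) (continuous_eval_const 1)).measurableSet
  exact (measurableSet_lt measurable_const measurable_fst).inter (measurable_snd h1)

theorem mk_driftPath_mem_image_iff {γ : C(AddCircle (1 : ℝ), FlatTorus Λ)} {τ : ℂ}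
    (hγ : γ ∈ windingClass Λ τ) {u : ℝ} (hu : 0 < u) (x : FlatTorus Λ) (l : Λ) {b : C(I, ℂ)}
    (hb0 : b 0 = 0) (hb1 : b 1 = 0) :
    (u, driftPath x l b) ∈ ParametrizedLoop.val '' (ParametrizedLoop.toUnrooted ⁻¹' freeHomotopyClass γ) ↔
      (l : ℂ) = τ := by
  have h : driftPath x (l : ℂ) b 0 = driftPath x (l : ℂ) b 1 := by
    simp [driftPath_apply, hb0, hb1, torusMk_zero, torusMk_eq_zero.2 l.2]
  have hl := circleLoop_driftPath_mem_windingClass l.2 x b (hb0.trans hb1.symm) h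
  constructor
  · rintro ⟨p, hp, hpe⟩
    obtain ⟨⟨v, W⟩, hv⟩ := p
    cases hpe
    exact eq_of_mem_windingClass hl ((mk_mem_freeHomotopyClass_iff hγ).1 hp)
  · rintro hlτ
    refine ⟨⟨(u, driftPath x l b), hu, h⟩, ?_, rfl⟩
    exact (mk_mem_freeHomotopyClass_iff hγ).2 (hlτ ▸ hl)

variable [IsZLattice ℝ Λ]

theorem dirac_prod_latticeBridge_apply (P : Measure C(ℝ≥0, ℂ)) [IsProbabilityMeasure P] (t : ℝ≥0)
    (x : FlatTorus Λ) (u : ℝ) {s : Set (ℝ × C(I, FlatTorus Λ))} (hs : MeasurableSet s) :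
    (Measure.dirac u).prod (latticeBridge P t x) s =
      ∑' l : Λ, ENNReal.ofReal (heatKernel 0 l t) *
        P {B | (u, driftPath x l (bridgePart t B)) ∈ s} := by
  have : SFinite (latticeBridge P t x) := by
    unfold latticeBridge
    infer_instance
  have hs' : MeasurableSet (Prod.mk u ⁻¹' s) := measurable_prodMk_left hs
  rw [Measure.dirac_prod, Measure.map_apply measurable_prodMk_left hs, latticeBridge,
    Measure.sum_apply _ hs']
  refine tsum_congr fun l => ?_
  rw [Measure.smul_apply, Measure.map_apply (measurable_driftPath_bridgePart t x l) hs',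
    smul_eq_mul]
  rfl

/-- Each term is measurable by joint continuity of the path in time, base point and Brownian path.
Unlike `torusBridge`, a limit identified only for `t > 0`, the explicit series can be handled at all
times. -/
theorem measurable_dirac_prod_latticeBridge (P : Measure C(ℝ≥0, ℂ)) [IsProbabilityMeasure P] :
    Measurable fun p : ℝ × FlatTorus Λ =>
      (Measure.dirac p.1).prod (latticeBridge P p.1.toNNReal p.2) := by
  refine Measure.measurable_of_measurable_coe _ fun s hs => ?_
  simp only [dirac_prod_latticeBridge_apply P _ _ _ hs]
  refine Measurable.tsum fun l => .mul ?_ ?_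
  · have : Measurable fun p : ℝ × FlatTorus Λ => ((l : ℂ), (p.1.toNNReal : ℝ)) := by fun_prop
    exact ((measurable_heatKernel 0).comp this).ennreal_ofReal
  · have hc : Continuous fun q : (ℝ × FlatTorus Λ) × C(ℝ≥0, ℂ) =>
        driftPath q.1.2 (l : ℂ) (bridgePart q.1.1.toNNReal q.2) := by
      have h1 : Continuous fun q : (ℝ × FlatTorus Λ) × C(ℝ≥0, ℂ) =>
          bridgePart q.1.1.toNNReal q.2 :=
        continuous_bridgePart.comp (by fun_prop : Continuous
          fun q : (ℝ × FlatTorus Λ) × C(ℝ≥0, ℂ) => (q.1.1.toNNReal, q.2))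
      exact continuous_driftPath.comp (by fun_prop : Continuous
        fun q : (ℝ × FlatTorus Λ) × C(ℝ≥0, ℂ) =>
          (q.1.2, (l : ℂ), bridgePart q.1.1.toNNReal q.2))
    have hm : Measurable fun q : (ℝ × FlatTorus Λ) × C(ℝ≥0, ℂ) =>
        (q.1.1, driftPath q.1.2 (l : ℂ) (bridgePart q.1.1.toNNReal q.2)) :=
      (measurable_fst.comp measurable_fst).prodMk hc.measurable
    exact measurable_measure_prodMk_left (hm hs)

theorem brownianLoopMeasure_freeHomotopyClass {P : ProbabilityMeasure C(ℝ≥0, ℂ)}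
    (hP : IsPlanarBrownianLaw (P : Measure C(ℝ≥0, ℂ))) {γ : C(AddCircle (1 : ℝ), FlatTorus Λ)}
    {τ : ℂ} (hγ : γ ∈ windingClass Λ τ) :
    brownianLoopMeasure Λ P (freeHomotopyClass γ) =
      ∫⁻ t in Ioi (0 : ℝ), ENNReal.ofReal (1 / t) *
        (ENNReal.ofReal (heatKernel 0 τ t) * torusVolume Λ univ) := by
  have hC : MeasurableSet (freeHomotopyClass γ) := (isOpen_freeHomotopyClass hγ).measurableSet
  have hA := measurable_toUnrooted hC
  have hA' := measurableEmbedding_parametrizedLoop.measurableSet_image.2 hA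
  set μ : Measure ℝ := ((volume : Measure ℝ).restrict (Ioi 0)).withDensity
    fun t => ENNReal.ofReal (1 / t) with hμ
  have hcomap : parametrizedLoopMeasure Λ P (ParametrizedLoop.toUnrooted ⁻¹' freeHomotopyClass γ) =
      (μ.prod (torusVolume Λ)).bind (fun p => (Measure.dirac p.1).prod
        (torusBridge P p.1.toNNReal p.2 p.2 : Measure C(I, FlatTorus Λ)))
        (ParametrizedLoop.val '' (ParametrizedLoop.toUnrooted ⁻¹' freeHomotopyClass γ)) :=
    measurableEmbedding_parametrizedLoop.comap_apply _ _
  rw [brownianLoopMeasure, Measure.map_apply measurable_toUnrooted hC, hcomap]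
  have hpos : ∀ᵐ p ∂μ.prod (torusVolume Λ), 0 < p.1 := by
    refine Measure.quasiMeasurePreserving_fst.ae ?_
    exact (withDensity_absolutelyContinuous _ _).ae_le (ae_restrict_mem measurableSet_Ioi)
  have hker : ∀ᵐ p ∂μ.prod (torusVolume Λ),
      (Measure.dirac p.1).prod (torusBridge P p.1.toNNReal p.2 p.2 : Measure C(I, FlatTorus Λ)) =
        (Measure.dirac p.1).prod (latticeBridge P p.1.toNNReal p.2) := by
    filter_upwards [hpos] with p hp
    rw [torusBridge_eq hP (Real.toNNReal_pos.2 hp)]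
  -- The bridge kernel agrees almost everywhere with a measurable one, which is enough to evaluate
  -- `bind`.
  rw [Measure.bind_apply hA' ⟨_, measurable_dirac_prod_latticeBridge (P : Measure C(ℝ≥0, ℂ)), hker⟩]
  have hval : ∀ᵐ p ∂μ.prod (torusVolume Λ),
      (Measure.dirac p.1).prod (torusBridge P p.1.toNNReal p.2 p.2 : Measure C(I, FlatTorus Λ))
        (ParametrizedLoop.val '' (ParametrizedLoop.toUnrooted ⁻¹' freeHomotopyClass γ)) =
        ENNReal.ofReal (heatKernel 0 τ p.1) := by
    filter_upwards [hpos, hker] with p hp hpk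
    rw [hpk, dirac_prod_latticeBridge_apply _ _ _ _ hA', Real.coe_toNNReal _ hp.le]
    have hae (l : Λ) : ∀ᵐ B ∂(P : Measure C(ℝ≥0, ℂ)),
        (p.1, driftPath p.2 l (bridgePart p.1.toNNReal B)) ∈
          ParametrizedLoop.val '' (ParametrizedLoop.toUnrooted ⁻¹' freeHomotopyClass γ) ↔ (l : ℂ) = τ := by
      filter_upwards [hP.ae_apply_zero] with B hB
      exact mk_driftPath_mem_image_iff hγ hp p.2 l (by rw [bridgePart_apply_zero, hB])
        (bridgePart_apply_one _ B)
    rw [tsum_eq_single (⟨τ, mem_lattice_of_mem_windingClass hγ⟩ : Λ)]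
    · have : {B | (p.1, driftPath p.2 τ (bridgePart p.1.toNNReal B)) ∈
          ParametrizedLoop.val '' (ParametrizedLoop.toUnrooted ⁻¹' freeHomotopyClass γ)}
          =ᵐ[(P : Measure C(ℝ≥0, ℂ))] univ := by
        refine eventuallyEq_univ.2 ?_
        filter_upwards [hae ⟨τ, mem_lattice_of_mem_windingClass hγ⟩] with B hB using hB.2 rfl
      rw [measure_congr this, measure_univ, mul_one]
    · intro l hl
      have : (P : Measure C(ℝ≥0, ℂ)) {B | (p.1, driftPath p.2 l (bridgePart p.1.toNNReal B)) ∈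
          ParametrizedLoop.val '' (ParametrizedLoop.toUnrooted ⁻¹' freeHomotopyClass γ)} = 0 := by
        refine measure_eq_zero_iff_ae_notMem.2 ?_
        filter_upwards [hae l] with B hB hmem
        exact hl (Subtype.ext (hB.1 hmem))
      rw [this, mul_zero]
  have hmeas : Measurable fun t => ENNReal.ofReal (heatKernel 0 τ t) :=
    ((measurable_heatKernel 0).comp measurable_prodMk_left).ennreal_ofReal
  have hmeas' : Measurable fun p : ℝ × FlatTorus Λ => ENNReal.ofReal (heatKernel 0 τ p.1) :=
    hmeas.comp measurable_fst
  rw [lintegral_congr_ae hval, lintegral_prod _ hmeas'.aemeasurable]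
  simp only [lintegral_const]
  rw [hμ, lintegral_withDensity_eq_lintegral_mul _ (by fun_prop) (hmeas.mul_const _)]
  rfl

end LoopMeasure

/-! ### The time integral -/

/-- The integrand is the derivative of `exp (-‖τ‖² / 4t) / (π ‖τ‖²)`, which rises from `0` at `t =
0+` to `1 / (π ‖τ‖²)` at infinity. -/
theorem lintegral_Ioi_inv_mul_heatKernel {τ : ℂ} (hτ : τ ≠ 0) :
    ∫⁻ t in Ioi (0 : ℝ), ENNReal.ofReal (1 / t) * ENNReal.ofReal (heatKernel 0 τ t) =
      ENNReal.ofReal (1 / (Real.pi * ‖τ‖ ^ 2)) := by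
  have hn : 0 < ‖τ‖ := norm_pos_iff.2 hτ
  set c : ℝ := ‖τ‖ ^ 2 / 4 with hc
  have hc0 : 0 < c := by positivity
  -- `expNegInvGlue` is `exp (-1 / x)` for `x > 0` and `0` otherwise, so the antiderivative is
  -- continuous at the endpoint `0`.
  let g : ℝ → ℝ := fun t => 1 / (Real.pi * ‖τ‖ ^ 2) * expNegInvGlue (t / c)
  have hg : Continuous g := by
    have := expNegInvGlue.contDiff (n := 0)
    have := this.continuous
    fun_prop
  have hderiv : ∀ t ∈ Ioi (0 : ℝ), HasDerivAt g (1 / t * heatKernel 0 τ t) t := by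
    intro t ht
    have ht : 0 < t := ht
    have h1 : HasDerivAt (fun t : ℝ => 1 / (Real.pi * ‖τ‖ ^ 2) * Real.exp (-(t / c)⁻¹))
        (1 / (Real.pi * ‖τ‖ ^ 2) * (Real.exp (-(t / c)⁻¹) * -(-(1 / c) / (t / c) ^ 2))) t :=
      ((((hasDerivAt_id t).div_const c).fun_inv (by positivity)).fun_neg.exp).const_mul _
    refine (h1.congr_deriv ?_).congr_of_eventuallyEq ?_
    · have h2 : -(t / c)⁻¹ = -‖τ‖ ^ 2 / (4 * t) := by
        rw [hc]
        field_simp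
      rw [heatKernel, zero_sub, norm_neg, h2, hc]
      field_simp
    · filter_upwards [lt_mem_nhds ht] with s hs
      have : ¬ s / c ≤ 0 := not_le.2 (by positivity)
      simp [g, expNegInvGlue, this]
  have hnonneg : ∀ t ∈ Ioi (0 : ℝ), 0 ≤ 1 / t * heatKernel 0 τ t := fun t ht =>
    mul_nonneg (one_div_nonneg.2 (le_of_lt ht)) (heatKernel_nonneg _ _ (le_of_lt ht))
  have hlim : Tendsto g atTop (𝓝 (1 / (Real.pi * ‖τ‖ ^ 2))) := by
    have h1 : Tendsto (fun t : ℝ => 1 / (Real.pi * ‖τ‖ ^ 2) * Real.exp (-(t / c)⁻¹)) atTop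
        (𝓝 (1 / (Real.pi * ‖τ‖ ^ 2) * Real.exp (-0))) :=
      ((Real.continuous_exp.tendsto _).comp (tendsto_inv_atTop_zero.comp
        (tendsto_id.atTop_div_const hc0)).neg).const_mul _
    rw [neg_zero, Real.exp_zero, mul_one] at h1
    refine h1.congr' ?_
    filter_upwards [eventually_gt_atTop 0] with s hs
    have : ¬ s / c ≤ 0 := not_le.2 (by positivity)
    simp [g, expNegInvGlue, this]
  have hint := integrableOn_Ioi_deriv_of_nonneg hg.continuousWithinAt hderiv hnonneg hlim
  have hval := integral_Ioi_of_hasDerivAt_of_nonneg hg.continuousWithinAt hderiv hnonneg hlim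
  have hg0 : g 0 = 0 := by simp [g, expNegInvGlue]
  rw [hg0, sub_zero] at hval
  rw [← hval, ofReal_integral_eq_lintegral_ofReal hint
    ((ae_restrict_iff' measurableSet_Ioi).2 (.of_forall hnonneg))]
  refine setLIntegral_congr_fun measurableSet_Ioi fun t ht => ?_
  exact (ENNReal.ofReal_mul (one_div_nonneg.2 (le_of_lt ht))).symm

theorem lemma3p3 (Λ : Submodule ℤ ℂ) [DiscreteTopology Λ] [IsZLattice ℝ Λ]
    (P : ProbabilityMeasure C(ℝ≥0, ℂ)) (hP : IsPlanarBrownianLaw (P : Measure C(ℝ≥0, ℂ)))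
    (γ : C(AddCircle (1 : ℝ), FlatTorus Λ)) (τ : ℂ) (hγ : IsClosedGeodesic γ τ)
    (F : Set ℂ) (hF : IsAddFundamentalDomain Λ F (volume : Measure ℂ)) :
    brownianLoopMeasure Λ P (freeHomotopyClass γ) =
        ∫⁻ t in Ioi (0 : ℝ), ENNReal.ofReal (1 / t) *
          ∫⁻ z in F, ENNReal.ofReal (heatKernel z (z + τ) t) ∧
      brownianLoopMeasure Λ P (freeHomotopyClass γ) =
        ENNReal.ofReal (torusArea Λ / (Real.pi * ‖τ‖ ^ 2)) := by
  have hmain := brownianLoopMeasure_freeHomotopyClass hP hγ.mem_windingClass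
  constructor
  · rw [hmain]
    refine lintegral_congr fun t => ?_
    -- By translation invariance the integrand is constant on `F`, and all fundamental domains have
    -- the same area.
    have hk (z : ℂ) : heatKernel z (z + τ) t = heatKernel 0 τ t := by
      simp [heatKernel]
    simp only [hk]
    rw [setLIntegral_const, torusVolume_univ,
      (isAddFundamentalDomain_latticeDomain Λ).measure_eq hF]
  · have hmeas : Measurable fun t =>
        ENNReal.ofReal (1 / t) * ENNReal.ofReal (heatKernel 0 τ t) :=
      Measurable.mul (by fun_prop)
        ((measurable_heatKernel 0).comp measurable_prodMk_left).ennreal_ofReal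
    rw [hmain]
    simp only [← mul_assoc]
    rw [lintegral_mul_const _ hmeas, lintegral_Ioi_inv_mul_heatKernel hγ.1, torusArea,
      ← ENNReal.ofReal_toReal (measure_ne_top (torusVolume Λ) univ),
      ← ENNReal.ofReal_mul (by positivity), Measure.real, mul_comm, mul_one_div]
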